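/- Write $\Sigma_k=\{0,1,\dots,k-1\}$, and let $\Sigma_k^*$ and $\Sigma_k^\omega$ be the sets of finite and of infinite words over $\Sigma_k$. A finite word of length $n$ is rich if it has exactly $n$ distinct nonempty palindromic factors; an infinite word is rich if all of its finite factors are rich. A positive integer $p$ is a period of a finite nonempty word $u=u_1\cdots u_\ell$ if $u_i=u_{i+p}$ for all $1\le i\le \ell-p$, and then $\ell/p$ is called an exponent of $u$. An infinite word is $14/5$-free if no nonempty finite factor of it has an exponent greater than or equal to $14/5$. Let $f:\Sigma_3^*\to\Sigma_2^*$ and $g,h:\Sigma_3^*\to\Sigma_3^*$ be the morphisms given by $$f(0)=0,\quad f(1)=01,\quad f(2)=011,$$ $$g(0)=011,\quad g(1)=0121,\quad g(2)=012121,$$ $$h(0)=01,\quad h(1)=02,\quad h(2)=022,$$ extended to infinite words by concatenating the images of the letters. Theorem. Let $w\in\Sigma_2^\omega$ be rich and $14/5$-free. Then for every $n\ge 1$ there is an infinite word $w_n\in\Sigma_3^\omega$ such that some suffix of $w$ is equal to $f(h^n(w_n))$ or to $f(g(h^n(w_n)))$. -/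

import Mathlib

namespace BinaryRich

/-! Finite words over `α` are lists, infinite words over `α` are functions `ℕ → α`, and the
alphabet of size `k` is `Fin k`. -/

/-- The factor of length `n` of the infinite word `w` that starts at position `i`. -/
def factor {α : Type*} (w : ℕ → α) (i n : ℕ) : List α :=
  (List.range n).map fun j => w (i + j)

/-- The suffix of the infinite word `w` that starts at position `i`. -/
def suffix {α : Type*} (w : ℕ → α) (i : ℕ) : ℕ → α :=
  fun j => w (i + j)

/-- The set of (distinct) nonempty palindromic factors of a finite word. -/
def palindromicFactors {α : Type*} (u : List α) : Set (List α) :=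
  {v | v ≠ [] ∧ v <:+: u ∧ v.Palindrome}

/-- A finite word of length `n` is rich if it has `n` distinct nonempty palindromic factors. -/
def IsRich {α : Type*} (u : List α) : Prop :=
  (palindromicFactors u).ncard = u.length

/-- The set counted in the definition of richness is finite. -/
theorem palindromicFactors_finite {α : Type*} (u : List α) : (palindromicFactors u).Finite := by
  refine (u.sublists.finite_toSet).subset ?_
  rintro v ⟨-, hv, -⟩
  exact List.mem_sublists.mpr hv.sublist

/-- An infinite word is rich if all its finite factors are rich. -/
def IsRichInf {α : Type*} (w : ℕ → α) : Prop :=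
  ∀ i n : ℕ, IsRich (factor w i n)

/-- `e` is an exponent of the nonempty finite word `u`: `e = |u| / p` for some period `p ≥ 1`
of `u`. -/
def IsExponent {α : Type*} (u : List α) (e : ℝ) : Prop :=
  ∃ p : ℕ, 0 < p ∧ u.HasPeriod p ∧ e = (u.length : ℝ) / (p : ℝ)

/-- An infinite word is `a`-free if it has no nonempty factor with an exponent that is at
least `a`. -/
def PowerFree {α : Type*} (a : ℝ) (w : ℕ → α) : Prop :=
  ∀ i n : ℕ, factor w i n ≠ [] → ∀ e : ℝ, IsExponent (factor w i n) e → e < a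

/-- A nonerasing morphism from words over `α` to words over `β`, given by the (nonempty) images
of the letters. -/
structure Morphism (α β : Type*) where
  /-- the image of a letter -/
  toFun : α → List β
  nonerasing : ∀ a, toFun a ≠ []

namespace Morphism

variable {α β : Type*}

/-- The image of a finite word: the concatenation of the images of its letters. -/
def onList (φ : Morphism α β) (u : List α) : List β :=
  u.flatMap φ.toFun

theorem length_le_onList (φ : Morphism α β) (u : List α) :
    u.length ≤ (φ.onList u).length := by
  induction u with
  | nil => simp
  | cons a u ih =>
    have h := List.length_pos_of_ne_nil (φ.nonerasing a)
    simp only [onList, List.flatMap_cons, List.length_append, List.length_cons] at ih ⊢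
    omega

theorem lt_length_onList_factor (φ : Morphism α β) (w : ℕ → α) (i : ℕ) :
    i < (φ.onList (factor w 0 (i + 1))).length := by
  have h := φ.length_le_onList (factor w 0 (i + 1))
  simp only [factor, List.length_map, List.length_range] at h ⊢
  omega

/-- The image of an infinite word, i.e. the infinite concatenation of the images of its letters.
Its letter at position `i` can be read off from the image of the prefix of length `i + 1`, which
has more than `i` letters. -/
def onInf (φ : Morphism α β) (w : ℕ → α) : ℕ → β :=
  fun i => (φ.onList (factor w 0 (i + 1)))[i]'(φ.lt_length_onList_factor w i)

/-- The image of an infinite word `w` is characterized by having the images of all the prefixes of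
`w` as prefixes. -/
theorem factor_onInf (φ : Morphism α β) (w : ℕ → α) (n : ℕ) :
    factor (φ.onInf w) 0 (φ.onList (factor w 0 n)).length = φ.onList (factor w 0 n) := by
  have mono : ∀ m k : ℕ, φ.onList (factor w 0 m) <+: φ.onList (factor w 0 (m + k)) := by
    intro m k
    refine ⟨(factor (suffix w m) 0 k).flatMap φ.toFun, ?_⟩
    simp [onList, factor, suffix, List.range_add, List.flatMap_append, List.map_map,
      Function.comp_def]
  apply List.ext_getElem
  · simp [factor]
  · intro i h₁ h₂
    have key : ∀ a b : ℕ, a ≤ b → ∀ (ha : i < (φ.onList (factor w 0 a)).length)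
        (hb : i < (φ.onList (factor w 0 b)).length),
        (φ.onList (factor w 0 a))[i] = (φ.onList (factor w 0 b))[i] := by
      intro a b hab ha hb
      obtain ⟨k, rfl⟩ := Nat.exists_eq_add_of_le hab
      exact (mono a k).getElem ha
    have e : (factor (φ.onInf w) 0 (φ.onList (factor w 0 n)).length)[i] = φ.onInf w i := by
      simp [factor]
    rw [e]
    rcases le_total (i + 1) n with hin | hin
    · exact key _ _ hin _ _
    · exact (key _ _ hin _ _).symm

end Morphism

/-- `0 ↦ 0`, `1 ↦ 01`, `2 ↦ 011`. -/
def f : Morphism (Fin 3) (Fin 2) where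
  toFun := ![[0], [0, 1], [0, 1, 1]]
  nonerasing := by decide

/-- `0 ↦ 011`, `1 ↦ 0121`, `2 ↦ 012121`. -/
def g : Morphism (Fin 3) (Fin 3) where
  toFun := ![[0, 1, 1], [0, 1, 2, 1], [0, 1, 2, 1, 2, 1]]
  nonerasing := by decide

/-- `0 ↦ 01`, `1 ↦ 02`, `2 ↦ 022`. -/
def h : Morphism (Fin 3) (Fin 3) where
  toFun := ![[0, 1], [0, 2], [0, 2, 2]]
  nonerasing := by decide

end BinaryRich

/-! Both hypotheses descend through the morphisms, so only finitely many desubstitution statements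
are needed, and each is settled by a finite search.

Richness enters as `HasNewPalindromes`: every nonempty factor ends in a palindrome that did not
occur earlier in it. The images under `f`, `g` and `h` are `0` followed by a palindrome without `0`.
Hence `s` is a palindrome exactly when the image of `s` followed by `0` is one, and the property
passes from an image to its preimage (`Morphism.IsMarked.hasNewPalindromes`).

Power-freeness becomes an inequality between weights of words. Pulling it back along a morphism
changes the letter weights and adds a constant for the common prefix of the images
(`RepetitionFree.of_onInf`). A repetition that is too long for several weights is too long for their
nonnegative combinations (`RepetitionFree.mono`). The weights arising from `f`, `f ∘ g` and further
applications of `h` all lie in the cone spanned by `ternaryGens`, so one condition serves every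
depth of iteration.

A depth first search with these two obstructions then shows that a preimage under `f` is eventually
cut into blocks of `h` or of `g`, and that a preimage under `f ∘ h`, `f ∘ g`, `g ∘ h` or `h ∘ h` is
eventually cut into blocks of `h`. Induction on `n` adds one `h` at a time on the inside. -/

namespace BinaryRich

/-! ### Factors and suffixes of infinite words -/

section Words

variable {α β : Type*}

@[simp]
theorem length_factor (w : ℕ → α) (i n : ℕ) : (factor w i n).length = n := by
  simp [factor]

@[simp]
theorem factor_zero (w : ℕ → α) (i : ℕ) : factor w i 0 = [] := rfl

theorem factor_add (w : ℕ → α) (i m n : ℕ) :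
    factor w i (m + n) = factor w i m ++ factor w (i + m) n := by
  simp [factor, List.range_add, List.map_map, Function.comp_def, Nat.add_assoc]

theorem factor_one (w : ℕ → α) (i : ℕ) : factor w i 1 = [w i] := rfl

theorem factor_succ (w : ℕ → α) (i n : ℕ) : factor w i (n + 1) = factor w i n ++ [w (i + n)] :=
  factor_add w i n 1

theorem factor_suffix (w : ℕ → α) (i j n : ℕ) :
    factor (suffix w i) j n = factor w (i + j) n := by
  simp [factor, suffix, Nat.add_assoc]

theorem suffix_suffix (w : ℕ → α) (i j : ℕ) : suffix (suffix w i) j = suffix w (i + j) := by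
  funext k
  simp [suffix, Nat.add_assoc]

theorem factor_eq_factor_iff (v w : ℕ → α) (i j n : ℕ) :
    factor v i n = factor w j n ↔ ∀ k < n, v (i + k) = w (j + k) := by
  simp [factor]

end Words

/-! ### Images of infinite words and parsing into blocks -/

namespace Morphism

variable {α β γ : Type*}

@[simp]
theorem onList_nil (φ : Morphism α β) : φ.onList [] = [] := rfl

@[simp]
theorem onList_append (φ : Morphism α β) (u v : List α) :
    φ.onList (u ++ v) = φ.onList u ++ φ.onList v := by
  simp [onList]

theorem onList_cons (φ : Morphism α β) (a : α) (u : List α) :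
    φ.onList (a :: u) = φ.toFun a ++ φ.onList u := by
  simp [onList]

@[simp]
theorem onList_singleton (φ : Morphism α β) (a : α) : φ.onList [a] = φ.toFun a := by
  simp [onList]

theorem eq_onInf (φ : Morphism α β) (v : ℕ → α) (w : ℕ → β)
    (hw : ∀ n, factor w 0 (φ.onList (factor v 0 n)).length = φ.onList (factor v 0 n)) :
    w = φ.onInf v := by
  funext i
  have h₁ := (hw (i + 1)).trans (φ.factor_onInf v (i + 1)).symm
  rw [factor_eq_factor_iff] at h₁
  simpa using h₁ i (φ.lt_length_onList_factor v i)

theorem factor_onInf' (φ : Morphism α β) (v : ℕ → α) (i n : ℕ) :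
    factor (φ.onInf v) (φ.onList (factor v 0 i)).length (φ.onList (factor v i n)).length =
      φ.onList (factor v i n) := by
  have h₁ := φ.factor_onInf v (i + n)
  rw [factor_add, onList_append, List.length_append, factor_add, φ.factor_onInf v i] at h₁
  simpa using h₁

theorem suffix_onInf (φ : Morphism α β) (v : ℕ → α) (i : ℕ) :
    suffix (φ.onInf v) (φ.onList (factor v 0 i)).length = φ.onInf (suffix v i) := by
  apply eq_onInf
  intro n
  simpa [factor_suffix] using φ.factor_onInf' v i n

/-- The composition of morphisms. -/
def comp (φ : Morphism β γ) (ψ : Morphism α β) : Morphism α γ where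
  toFun a := φ.onList (ψ.toFun a)
  nonerasing a := by
    have h₁ := φ.length_le_onList (ψ.toFun a)
    have h₂ := List.length_pos_of_ne_nil (ψ.nonerasing a)
    exact List.ne_nil_of_length_pos (h₂.trans_le h₁)

theorem comp_onList (φ : Morphism β γ) (ψ : Morphism α β) (u : List α) :
    (φ.comp ψ).onList u = φ.onList (ψ.onList u) := by
  simp [onList, comp, List.flatMap_assoc]

theorem comp_onInf (φ : Morphism β γ) (ψ : Morphism α β) (v : ℕ → α) :
    (φ.comp ψ).onInf v = φ.onInf (ψ.onInf v) := by
  refine (eq_onInf _ _ _ fun n => ?_).symm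
  have h₁ := φ.factor_onInf (ψ.onInf v) (ψ.onList (factor v 0 n)).length
  rwa [ψ.factor_onInf v n, ← comp_onList] at h₁

theorem exists_suffix_onInf (φ : Morphism α β) {v v' : ℕ → α} (hv : ∃ i, suffix v i = v') :
    ∃ i, suffix (φ.onInf v) i = φ.onInf v' := by
  obtain ⟨i, rfl⟩ := hv
  exact ⟨_, φ.suffix_onInf v i⟩

/-- If `v` can be cut into images of letters from position `i` on, then its suffix at `i` is the
image of an infinite word. -/
theorem exists_eq_onInf (φ : Morphism α β) (v : ℕ → β) (P : ℕ → Prop)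
    (hstep : ∀ i, P i → ∃ a, factor v i (φ.toFun a).length = φ.toFun a ∧
      P (i + (φ.toFun a).length))
    (i : ℕ) (hi : P i) : ∃ v' : ℕ → α, suffix v i = φ.onInf v' := by
  have hne : ∀ j, ∃ a, P j → factor v j (φ.toFun a).length = φ.toFun a ∧
      P (j + (φ.toFun a).length) := by
    intro j
    by_cases hj : P j
    · obtain ⟨a, ha⟩ := hstep j hj
      exact ⟨a, fun _ => ha⟩
    -- Positions outside `P` are never visited; any letter serves as a default there, and `hstep i
    -- hi` supplies one.
    · obtain ⟨a, -⟩ := hstep i hi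
      exact ⟨a, fun h => absurd h hj⟩
  choose c hc using hne
  let pos : ℕ → ℕ := fun n => (fun j => j + (φ.toFun (c j)).length)^[n] i
  have pos_succ : ∀ n, pos (n + 1) = pos n + (φ.toFun (c (pos n))).length := fun n => by
    simp only [pos, Function.iterate_succ_apply']
  have hpos : ∀ n, P (pos n) := by
    intro n
    induction n with
    | zero => exact hi
    | succ n ih => rw [pos_succ]; exact (hc _ ih).2
  refine ⟨fun n => c (pos n), eq_onInf _ _ _ fun n => ?_⟩
  have key : pos n = i + (φ.onList (factor (fun n => c (pos n)) 0 n)).length ∧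
      factor v i (φ.onList (factor (fun n => c (pos n)) 0 n)).length =
        φ.onList (factor (fun n => c (pos n)) 0 n) := by
    induction n with
    | zero => exact ⟨by simp [pos], by simp⟩
    | succ n ih =>
      rw [factor_succ, onList_append, List.length_append, onList_singleton, factor_add, ih.2,
        ← Nat.add_assoc, ← ih.1, pos_succ, Nat.zero_add,
        (hc _ (hpos n)).1]
      exact ⟨rfl, rfl⟩
  rw [factor_suffix, Nat.add_zero]
  exact key.2

/-- Whatever letter comes next, its image starts with `p`. -/
theorem exists_eq_append_of_prefix (φ : Morphism α β) {p : List β}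
    (hp : ∀ a, p <+: φ.toFun a) (v : ℕ → α) (i n : ℕ) :
    factor (φ.onInf v) (φ.onList (factor v 0 i)).length
        ((φ.onList (factor v i n)).length + p.length) = φ.onList (factor v i n) ++ p := by
  have h₁ := φ.factor_onInf' v i (n + 1)
  obtain ⟨q, hq⟩ := hp (v (i + n))
  rw [factor_succ, onList_append, onList_singleton, ← hq, ← List.append_assoc, List.length_append,
    factor_add] at h₁
  have h₂ := (List.append_inj h₁ (by simp)).1
  simpa using h₂

end Morphism

/-! ### Richness and its descent through marked morphisms -/

section NewPalindromes

variable {α β : Type*}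

/-- Every nonempty factor of `w` has a nonempty palindromic suffix that occurs only once in it. -/
def HasNewPalindromes (w : ℕ → α) : Prop :=
  ∀ i n, ∃ q : List α, q ≠ [] ∧ q.Palindrome ∧ q <:+ factor w i (n + 1) ∧ ¬ q <:+: factor w i n

theorem infix_append_singleton {q u : List α} {a : α} (hq : q <:+: u ++ [a]) :
    q <:+ u ++ [a] ∨ q <:+: u := by
  obtain ⟨s, t, hst⟩ := hq
  rcases List.eq_nil_or_concat t with rfl | ⟨t', b, rfl⟩
  · left; exact ⟨s, by simpa using hst⟩
  · right
    refine ⟨s, t', ?_⟩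
    rw [List.concat_eq_append, ← List.append_assoc] at hst
    exact (List.append_inj' hst rfl).1

/-- Without a new palindromic suffix, the last letter adds no palindrome, so `n + 1` palindromes
would lie in a set of `n`. -/
theorem IsRichInf.hasNewPalindromes {w : ℕ → α} (hw : IsRichInf w) : HasNewPalindromes w := by
  intro i n
  by_contra! hcon
  have hsub : palindromicFactors (factor w i (n + 1)) ⊆ palindromicFactors (factor w i n) := by
    rintro q ⟨hq, hinf, hpal⟩
    refine ⟨hq, ?_, hpal⟩
    rw [factor_succ] at hinf
    rcases infix_append_singleton hinf with h₁ | h₁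
    · rw [← factor_succ] at h₁
      exact hcon q hq hpal h₁
    · exact h₁
  have h₁ := Set.ncard_le_ncard hsub (palindromicFactors_finite _)
  have h₂ := hw i (n + 1)
  have h₃ := hw i n
  unfold IsRich at h₂ h₃
  simp only [length_factor] at h₂ h₃
  omega

theorem HasNewPalindromes.suffix {w : ℕ → α} (hw : HasNewPalindromes w) (i : ℕ) :
    HasNewPalindromes (suffix w i) := by
  intro j n
  simpa [factor_suffix] using hw (i + j) n

/-- The image of each letter is `z` followed by a palindrome without `z`. -/
def Morphism.IsMarked (φ : Morphism α β) (z : β) : Prop :=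
  ∀ a, ∃ b : List β, φ.toFun a = z :: b ∧ z ∉ b ∧ b.reverse = b

namespace Morphism.IsMarked

variable {φ : Morphism α β} {z : β}

theorem head_onList (hφ : φ.IsMarked z) (u : List α) :
    φ.onList u = [] ∨ ∃ l, φ.onList u = z :: l := by
  cases u with
  | nil => left; rfl
  | cons a u =>
    right
    obtain ⟨b, hb, -, -⟩ := hφ a
    exact ⟨b ++ φ.onList u, by simp [onList_cons, hb]⟩

/-- The letter `z` occurs only at block boundaries, so a suffix that starts with `z` is aligned with
the blocks. -/
theorem exists_suffix (hφ : φ.IsMarked z) (t : List α) (q : List β)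
    (hq : q <:+ φ.onList t) (hz : q = [] ∨ ∃ l, q = z :: l) :
    ∃ s, s <:+ t ∧ q = φ.onList s := by
  induction t with
  | nil => exact ⟨[], List.nil_suffix, by simpa using hq⟩
  | cons a t ih =>
    by_cases h₁ : q <:+ φ.onList t
    · obtain ⟨s, hs, hqs⟩ := ih h₁
      exact ⟨s, hs.trans (List.suffix_cons a t), hqs⟩
    · obtain ⟨b, hb, hzb, -⟩ := hφ a
      have h₂ : φ.onList (a :: t) = z :: (b ++ φ.onList t) := by simp [onList_cons, hb]
      rw [h₂, List.suffix_cons_iff] at hq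
      rcases hq with hq | hq
      · exact ⟨a :: t, List.suffix_rfl, by rw [h₂, hq]⟩
      · exfalso
        obtain ⟨p, hp⟩ := hq
        rcases List.append_eq_append_iff.mp hp with ⟨c, rfl, rfl⟩ | ⟨c, rfl, h₃⟩
        · rcases hz with hz | ⟨l, hz⟩
          · rw [List.append_eq_nil_iff] at hz
            exact h₁ (by simp [hz.1, hz.2])
          · cases c with
            | nil => exact h₁ (by simp)
            | cons x c =>
              simp only [List.cons_append, List.cons.injEq] at hz
              exact hzb (by simp [hz.1])
        · exact h₁ ⟨c, h₃.symm⟩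

theorem reverse_onList (hφ : φ.IsMarked z) (s : List α) :
    (φ.onList s ++ [z]).reverse = φ.onList s.reverse ++ [z] := by
  induction s with
  | nil => simp
  | cons a s ih =>
    obtain ⟨b, hb, -, hrev⟩ := hφ a
    have h₁ : φ.onList (a :: s) ++ [z] = (z :: b) ++ (φ.onList s ++ [z]) := by
      simp [onList_cons, hb]
    rw [h₁, List.reverse_append, ih]
    simp [hrev, hb]

theorem onList_injective (hφ : φ.IsMarked z) (hinj : Function.Injective φ.toFun) :
    Function.Injective φ.onList := by
  classical
  intro s
  induction s with
  | nil =>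
    intro t ht
    cases t with
    | nil => rfl
    | cons a t =>
      obtain ⟨b, hb, -⟩ := hφ a
      simp [onList_cons, hb] at ht
  | cons a s ih =>
    intro t ht
    obtain ⟨b, hb, hzb, -⟩ := hφ a
    cases t with
    | nil => simp [onList_cons, hb] at ht
    | cons a' t =>
      obtain ⟨b', hb', hzb', -⟩ := hφ a'
      simp only [onList_cons, hb, hb', List.cons_append, List.cons.injEq, true_and] at ht
      have key : ∀ (c : List β) (u : List α), z ∉ c →
          (c ++ φ.onList u).takeWhile (fun x => decide (x ≠ z)) = c := by
        intro c u hc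
        rw [List.takeWhile_append_of_pos]
        · rcases hφ.head_onList u with hu | ⟨l, hu⟩ <;> simp [hu]
        · intro x hx
          have : x ≠ z := fun hxz => hc (hxz ▸ hx)
          simpa using this
      have hbb : b = b' := by rw [← key b s hzb, ht, key b' t hzb']
      subst hbb
      have haa : a = a' := hinj (by rw [hb, hb'])
      rw [haa, ih (List.append_cancel_left ht)]

/-- The image of a factor of `v` is followed by `z`. A new palindrome ending in this `z` also starts
with `z`, so it is `φ.onList s ++ [z]` with `s` a suffix of the factor. Reversal commutes with this
encoding, so `s` is a palindrome. An earlier occurrence of `s` would give an earlier one of the new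
palindrome, since the next image starts with `z`. -/
theorem hasNewPalindromes (hφ : φ.IsMarked z) (hinj : Function.Injective φ.toFun) {v : ℕ → α}
    (hv : HasNewPalindromes (φ.onInf v)) : HasNewPalindromes v := by
  intro i n
  have hz : ∀ a, [z] <+: φ.toFun a := fun a => by
    obtain ⟨b, hb, -⟩ := hφ a
    exact ⟨b, by simp [hb]⟩
  obtain ⟨q, hq, hpal, hsuf, hinf⟩ := hv (φ.onList (factor v 0 i)).length
    (φ.onList (factor v i (n + 1))).length
  rw [φ.factor_onInf'] at hinf
  have h₁ := φ.exists_eq_append_of_prefix hz v i (n + 1)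
  simp only [List.length_singleton] at h₁
  rw [h₁] at hsuf
  obtain ⟨q₀, rfl⟩ : ∃ q₀, q = q₀ ++ [z] := by
    rcases List.eq_nil_or_concat q with rfl | ⟨q₀, b, rfl⟩
    · exact absurd rfl hq
    · obtain ⟨p, hp⟩ := hsuf
      rw [List.concat_eq_append, ← List.append_assoc] at hp
      have := (List.append_inj' hp rfl).2
      exact ⟨q₀, by simpa using this⟩
  have hq₀ : q₀ <:+ φ.onList (factor v i (n + 1)) := by
    obtain ⟨p, hp⟩ := hsuf
    rw [← List.append_assoc] at hp
    exact ⟨p, (List.append_inj' hp rfl).1⟩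
  have hhead : q₀ = [] ∨ ∃ l, q₀ = z :: l := by
    have h₂ := hpal.reverse_eq
    cases q₀ with
    | nil => left; rfl
    | cons x l =>
      right
      simp only [List.reverse_append, List.reverse_cons, List.reverse_nil, List.nil_append,
        List.cons_append, List.cons.injEq] at h₂
      exact ⟨l, by rw [h₂.1]⟩
  obtain ⟨s, hs, rfl⟩ := hφ.exists_suffix _ _ hq₀ hhead
  have hlast : ∀ u : List α, ∃ l, φ.onList (u ++ [v (i + n)]) = z :: l := by
    intro u
    rcases hφ.head_onList (u ++ [v (i + n)]) with h₂ | h₂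
    · obtain ⟨b, hb, -⟩ := hφ (v (i + n))
      simp [hb] at h₂
    · exact h₂
  refine ⟨s, ?_, ?_, hs, ?_⟩
  -- If `s` were empty, the new palindrome would be `z` alone, which already starts the image of the
  -- factor.
  · rintro rfl
    apply hinf
    obtain ⟨l, hl⟩ := hlast (factor v i n)
    rw [factor_succ, hl]
    exact ⟨[], l, by simp⟩
  · apply List.Palindrome.of_reverse_eq
    have h₂ := hpal.reverse_eq
    rw [hφ.reverse_onList] at h₂
    exact hφ.onList_injective hinj (List.append_cancel_right h₂)
  · rintro ⟨x, y, hxy⟩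
    apply hinf
    obtain ⟨l, hl⟩ := hlast y
    refine ⟨φ.onList x, l, ?_⟩
    rw [factor_succ, ← hxy]
    simp only [List.append_assoc, onList_append, onList_singleton] at hl ⊢
    rw [hl]
    simp

end Morphism.IsMarked

end NewPalindromes

/-! ### Weighted repetitions and their descent through morphisms -/

section Repetitions

variable {α β : Type*}

/-- The total weight of a word. -/
def weight (wt : α → ℕ) (u : List α) : ℕ := (u.map wt).sum

@[simp]
theorem weight_append (wt : α → ℕ) (u v : List α) :
    weight wt (u ++ v) = weight wt u + weight wt v := by
  simp [weight]

theorem weight_onList (φ : Morphism α β) (wt : β → ℕ) (u : List α) :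
    weight wt (φ.onList u) = weight (fun a => weight wt (φ.toFun a)) u := by
  induction u with
  | nil => rfl
  | cons a u ih =>
    rw [Morphism.onList_cons, weight_append, ih]
    simp [weight]

/-- For each repetition in `w` there is a weight in the list for which it is short, that is, its
exponent is less than `14 / 5`, even when the weight of the repetition is increased by the given
constant. -/
def RepetitionFree (gens : List ((α → ℕ) × ℕ)) (w : ℕ → α) : Prop :=
  ∀ i p m, 0 < p → (∀ j < m, w (i + j) = w (i + p + j)) →
    ∃ G ∈ gens, 5 * (weight G.1 (factor w i (p + m)) + G.2) < 14 * weight G.1 (factor w i p)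

theorem RepetitionFree.suffix {gens : List ((α → ℕ) × ℕ)} {w : ℕ → α} (hw : RepetitionFree gens w)
    (i : ℕ) : RepetitionFree gens (suffix w i) := by
  intro j p m hp hm
  simp only [factor_suffix]
  refine hw (i + j) p m hp fun k hk => ?_
  simpa [BinaryRich.suffix, Nat.add_assoc] using hm k hk

theorem PowerFree.repetitionFree {w : ℕ → α} (hw : PowerFree (14 / 5 : ℝ) w) :
    RepetitionFree [(fun _ => 1, 0)] w := by
  intro i p m hp hm
  refine ⟨_, List.mem_singleton_self _, ?_⟩
  have hper : (factor w i (p + m)).HasPeriod p := by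
    rw [List.hasPeriod_iff_getElem?]
    intro k hk
    simp only [length_factor] at hk
    have h₁ := hm k (by omega)
    simp [factor, show k < p + m by omega, show k + p < p + m by omega]
    rw [h₁]; congr 1; omega
  have h₁ := hw i (p + m) (by
    intro h₀
    have := congrArg List.length h₀
    simp at this
    omega) _ ⟨p, hp, hper, rfl⟩
  have hp' : (0 : ℝ) < p := by exact_mod_cast hp
  rw [length_factor, div_lt_div_iff₀ hp' (by norm_num)] at h₁
  have h₂ : (p + m) * 5 < 14 * p := by exact_mod_cast h₁
  simp [weight]
  omega

/-- The image of a repetition extends to the right by `p` with the same period, which accounts for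
the added constant `weight G.1 p`. -/
theorem RepetitionFree.of_onInf (φ : Morphism α β) {p : List β} (hp : ∀ a, p <+: φ.toFun a)
    {gens : List ((β → ℕ) × ℕ)} {v : ℕ → α} (hv : RepetitionFree gens (φ.onInf v)) :
    RepetitionFree
      (gens.map fun G => (fun a => weight G.1 (φ.toFun a), weight G.1 p + G.2)) v := by
  intro i k m hk hm
  have hfac : factor v i m = factor v (i + k) m := (factor_eq_factor_iff ..).2 hm
  have hpos : (φ.onList (factor v 0 (i + k))).length =
      (φ.onList (factor v 0 i)).length + (φ.onList (factor v i k)).length := by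
    rw [factor_add, Morphism.onList_append, List.length_append, Nat.zero_add]
  have h₁ := φ.exists_eq_append_of_prefix hp v i m
  have h₂ := φ.exists_eq_append_of_prefix hp v (i + k) m
  rw [← hfac, ← h₁, hpos, factor_eq_factor_iff] at h₂
  have h₃ := φ.length_le_onList (factor v i k)
  rw [length_factor] at h₃
  obtain ⟨G, hG, h₄⟩ := hv _ (φ.onList (factor v i k)).length _ (hk.trans_le h₃)
    fun j hj => (h₂ j hj).symm
  refine ⟨_, List.mem_map_of_mem hG, ?_⟩
  have h₅ := φ.exists_eq_append_of_prefix hp v i (k + m)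
  rw [factor_add v i k m, ← hfac, Morphism.onList_append, List.length_append, Nat.add_assoc] at h₅
  rw [h₅, φ.factor_onInf'] at h₄
  simp only [weight_append, weight_onList] at h₄ ⊢
  rw [factor_add, ← hfac, weight_append]
  omega

/-- The inequality is linear in the pair of weight and constant. If it failed for every member of
`gens'`, it would fail for each nonnegative combination, hence for every member of `gens`. -/
theorem RepetitionFree.mono {gens gens' : List ((α → ℕ) × ℕ)} {w : ℕ → α}
    (hw : RepetitionFree gens w)
    (hgens : ∀ G ∈ gens, ∃ c : ((α → ℕ) × ℕ) → ℕ,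
      (∀ a, G.1 a = (gens'.map fun G' => c G' * G'.1 a).sum) ∧
        G.2 = (gens'.map fun G' => c G' * G'.2).sum) :
    RepetitionFree gens' w := by
  intro i p m hp hm
  by_contra! hcon
  obtain ⟨G, hG, h₁⟩ := hw i p m hp hm
  obtain ⟨c, hc, hc'⟩ := hgens G hG
  have hwt : ∀ u : List α, weight G.1 u = (gens'.map fun G' => c G' * weight G'.1 u).sum := by
    intro u
    induction u with
    | nil => simp [weight]
    | cons a u ih =>
      simp only [weight, List.map_cons, List.sum_cons] at ih ⊢
      rw [ih, hc, ← List.sum_map_add]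
      simp only [Nat.mul_add]
  rw [hwt, hwt, hc', ← List.sum_map_add, ← List.sum_map_mul_left, ← List.sum_map_mul_left] at h₁
  refine absurd h₁ (not_lt.2 (List.sum_le_sum fun G' hG' => ?_))
  nlinarith [hcon G' hG', Nat.zero_le (c G')]

end Repetitions

/-! ### The search and its soundness -/

section Search

variable {α β : Type*}

/-- The length of the longest common prefix of two words. -/
def lcpLength [DecidableEq α] : List α → List α → ℕ
  | a :: s, b :: t => if a = b then lcpLength s t + 1 else 0
  | _, _ => 0

/-- Whether the reversal of `r` ends in a repetition that is too long for all of the given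
weights. -/
def hasHeavyRepetition [DecidableEq α] (gens : List ((α → ℕ) × ℕ)) (r : List α) :
    Bool :=
  (List.range r.length).any fun k =>
    let m := lcpLength r (r.drop (k + 1))
    Nat.blt 0 m && gens.all fun G =>
      Nat.ble (14 * weight G.1 (r.take (k + 1))) (5 * (weight G.1 (r.take (k + 1 + m)) + G.2))

/-- Whether the reversal of `r` has a nonempty palindromic suffix that occurs nowhere else in
it. -/
def hasNewPalindrome [DecidableEq α] (r : List α) : Bool :=
  r.reverse.tails.any fun s =>
    -- As `s` is a suffix of `r.reverse`, its reversal is a prefix of `r`; if `s` is one too, then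
    -- `s` is a palindrome.
    !s.isEmpty && s.isPrefixOf r && !(r.tail.tails.any fun t => s.isPrefixOf t)

/-- Append the letters of a word one by one to the reversal of `r`, as long as no obstruction is
met. -/
def extend [DecidableEq α] (gens : List ((α → ℕ) × ℕ)) :
    List α → List α → Option (List α)
  | r, [] => some r
  | r, b :: l =>
    if hasHeavyRepetition gens (b :: r) || !hasNewPalindrome (b :: r) then none
    else extend gens (b :: r) l

/-- Depth first search through the extensions of the word `x.reverse`, whose image has the
reversal `r`: every branch has to reach the goal or an obstruction. -/
def search [DecidableEq β] (im : Fin 3 → List β) (gens : List ((β → ℕ) × ℕ))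
    (goal : List (Fin 3) → Bool) : ℕ → List (Fin 3) → List β → Bool
  | 0, _, _ => false
  | k + 1, x, r => goal x.reverse || [0, 1, 2].all fun c =>
      match extend gens r (im c) with
      | none => true
      | some r' => search im gens goal k (c :: x) r'

theorem lcpLength_le_right [DecidableEq α] (s t : List α) : lcpLength s t ≤ t.length := by
  induction s generalizing t with
  | nil => simp [lcpLength]
  | cons a s ih =>
    cases t with
    | nil => simp [lcpLength]
    | cons b t =>
      simp only [lcpLength, List.length_cons]
      split_ifs
      · exact Nat.succ_le_succ (ih t)
      · exact Nat.zero_le _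

theorem take_lcpLength [DecidableEq α] (s t : List α) :
    s.take (lcpLength s t) = t.take (lcpLength s t) := by
  induction s generalizing t with
  | nil => simp [lcpLength]
  | cons a s ih =>
    cases t with
    | nil => simp [lcpLength]
    | cons b t =>
      simp only [lcpLength]
      split_ifs with hab
      · simp [hab, ih]
      · simp

theorem weight_reverse (wt : α → ℕ) (u : List α) : weight wt u.reverse = weight wt u := by
  simp [weight]

theorem take_reverse_factor (w : ℕ → α) (i k l : ℕ) :
    (factor w i (k + l)).reverse.take l = (factor w (i + k) l).reverse := by
  rw [factor_add, List.reverse_append]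
  exact List.take_left' (by simp)

theorem drop_reverse_factor (w : ℕ → α) (i k l : ℕ) :
    (factor w i (k + l)).reverse.drop l = (factor w i k).reverse := by
  rw [factor_add, List.reverse_append]
  exact List.drop_left' (by simp)

theorem RepetitionFree.hasHeavyRepetition_eq_false [DecidableEq α] {gens : List ((α → ℕ) × ℕ)}
    {w : ℕ → α} (hw : RepetitionFree gens w) (i n : ℕ) :
    hasHeavyRepetition gens (factor w i n).reverse = false := by
  rw [← Bool.not_eq_true]
  intro hcon
  simp only [hasHeavyRepetition, List.any_eq_true, List.mem_range, List.length_reverse,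
    length_factor, Bool.and_eq_true, List.all_eq_true, Nat.ble_eq] at hcon
  obtain ⟨k, hk, -, hall⟩ := hcon
  set m := lcpLength (factor w i n).reverse ((factor w i n).reverse.drop (k + 1)) with hm
  have hle : m ≤ n - (k + 1) := by
    simpa using lcpLength_le_right (factor w i n).reverse ((factor w i n).reverse.drop (k + 1))
  have htake := take_lcpLength (factor w i n).reverse ((factor w i n).reverse.drop (k + 1))
  rw [← hm] at htake
  clear_value m
  obtain ⟨d, rfl⟩ : ∃ d, n = d + (k + 1 + m) := ⟨n - (k + 1 + m), by omega⟩
  have e₁ : d + (k + 1 + m) = d + (k + 1) + m := by omega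
  have e₂ : d + (k + 1 + m) = d + m + (k + 1) := by omega
  have h₁ : factor w (i + d) m = factor w (i + d + (k + 1)) m := by
    have h₂ : (factor w i (d + (k + 1 + m))).reverse.take m =
        (factor w (i + d + (k + 1)) m).reverse := by
      rw [e₁, take_reverse_factor, Nat.add_assoc i d]
    have h₃ : ((factor w i (d + (k + 1 + m))).reverse.drop (k + 1)).take m =
        (factor w (i + d) m).reverse := by
      rw [e₂, drop_reverse_factor, take_reverse_factor]
    rw [h₂, h₃] at htake
    exact (List.reverse_injective htake).symm
  obtain ⟨G, hG, h₂⟩ := hw (i + d) (k + 1) m k.succ_pos ((factor_eq_factor_iff ..).1 h₁)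
  have h₃ := hall G hG
  rw [take_reverse_factor, e₂, take_reverse_factor, weight_reverse, weight_reverse] at h₃
  -- The search weighs the last period of the repetition, `RepetitionFree` the first; cutting the
  -- repetition in both ways shows that they weigh the same.
  have h₄ : weight G.1 (factor w (i + (d + m)) (k + 1)) = weight G.1 (factor w (i + d) (k + 1)) := by
    have h₅ := congrArg (weight G.1) (factor_add w (i + d) m (k + 1))
    rw [Nat.add_comm m, factor_add, ← h₁, weight_append, weight_append, Nat.add_assoc i d m] at h₅
    omega
  omega

theorem HasNewPalindromes.hasNewPalindrome_eq_true [DecidableEq α] {w : ℕ → α}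
    (hw : HasNewPalindromes w) (i n : ℕ) :
    hasNewPalindrome (factor w i (n + 1)).reverse = true := by
  obtain ⟨q, hq, hpal, hsuf, hinf⟩ := hw i n
  simp only [hasNewPalindrome, List.reverse_reverse, List.any_eq_true, List.mem_tails]
  refine ⟨q, hsuf, ?_⟩
  have h₁ : q <+: (factor w i (n + 1)).reverse := by
    have := List.reverse_prefix.2 hsuf
    rwa [hpal.reverse_eq] at this
  simp only [Bool.and_eq_true, Bool.not_eq_true', List.isEmpty_eq_false_iff,
    List.isPrefixOf_iff_prefix]
  refine ⟨⟨hq, h₁⟩, ?_⟩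
  rw [← Bool.not_eq_true]
  intro hcon
  simp only [List.any_eq_true, List.mem_tails, List.isPrefixOf_iff_prefix] at hcon
  obtain ⟨t, ht, hqt⟩ := hcon
  apply hinf
  have h₂ : q <:+: (factor w i n).reverse := by
    have h₃ := hqt.isInfix.trans ht.isInfix
    simpa [factor_succ] using h₃
  have h₃ := List.reverse_infix.2 h₂
  rwa [List.reverse_reverse, hpal.reverse_eq] at h₃

theorem extend_eq_some [DecidableEq α] {gens : List ((α → ℕ) × ℕ)} {w : ℕ → α}
    (hpal : HasNewPalindromes w) (hrep : RepetitionFree gens w) (l r : List α)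
    (h : ∃ n, r.reverse ++ l = factor w 0 n) : extend gens r l = some (l.reverse ++ r) := by
  induction l generalizing r with
  | nil => rfl
  | cons b l ih =>
    obtain ⟨n, hn⟩ := h
    have hlen : n = (r.length + 1) + l.length := by
      have := congrArg List.length hn
      simp at this
      omega
    have h₁ : (b :: r) = (factor w 0 (r.length + 1)).reverse := by
      rw [hlen, factor_add, List.append_cons] at hn
      have := (List.append_inj hn (by simp)).1
      rw [← this]
      simp
    simp only [extend]
    rw [if_neg, ih]
    · simp
    · exact ⟨n, by simpa using hn⟩
    · rw [h₁, hrep.hasHeavyRepetition_eq_false, hpal.hasNewPalindrome_eq_true]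
      simp

/-- The branch spelled by `v` itself never meets an obstruction, so the search can succeed on it
only by reaching the goal. -/
theorem exists_goal_of_search [DecidableEq β] (φ : Morphism (Fin 3) β)
    {gens : List ((β → ℕ) × ℕ)} {v : ℕ → Fin 3} (hpal : HasNewPalindromes (φ.onInf v))
    (hrep : RepetitionFree gens (φ.onInf v)) (goal : List (Fin 3) → Bool) (k : ℕ)
    (x : List (Fin 3)) (r : List β) (hsearch : search φ.toFun gens goal k x r = true)
    (hx : x.reverse = factor v 0 x.length) (hr : r = (φ.onList x.reverse).reverse) :
    ∃ n, goal (factor v 0 n) = true := by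
  induction k generalizing x r with
  | zero => simp [search] at hsearch
  | succ k ih =>
    rw [search, Bool.or_eq_true, List.all_eq_true] at hsearch
    rcases hsearch with h₁ | h₁
    · exact ⟨_, hx ▸ h₁⟩
    · have h₂ := h₁ (v x.length) (by generalize v x.length = c; fin_cases c <;> simp)
      have hx' : (v x.length :: x).reverse = factor v 0 (v x.length :: x).length := by
        rw [List.length_cons, factor_succ, ← hx]
        simp
      rw [extend_eq_some hpal hrep] at h₂
      · refine ih _ _ h₂ hx' ?_
        simp [hr]
      · refine ⟨(φ.onList (factor v 0 (x.length + 1))).length, ?_⟩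
        rw [φ.factor_onInf v (x.length + 1), factor_succ, ← hx, hr]
        simp

end Search

/-! ### From successful searches to desubstitution -/

section Desubstitution

variable {β : Type*}

/-- Whether each right infinite word with prefix `x` has to reach the goal. -/
def check [DecidableEq β] (φ : Morphism (Fin 3) β) (gens : List ((β → ℕ) × ℕ))
    (goal : List (Fin 3) → Bool) (x : List (Fin 3)) : Bool :=
  -- The depth bound 40 needs no justification: running out of it counts as failure.
  search φ.toFun gens goal 40 x.reverse (φ.onList x).reverse

theorem exists_goal_of_check [DecidableEq β] {φ : Morphism (Fin 3) β}
    {gens : List ((β → ℕ) × ℕ)} {goal : List (Fin 3) → Bool} {x : List (Fin 3)}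
    (hx : check φ gens goal x = true) {v : ℕ → Fin 3} (hpal : HasNewPalindromes (φ.onInf v))
    (hrep : RepetitionFree gens (φ.onInf v)) {i n : ℕ} (hv : factor v i n = x) :
    ∃ k, goal (factor v i k) = true := by
  have hpal' := hpal.suffix (φ.onList (factor v 0 i)).length
  have hrep' := hrep.suffix (φ.onList (factor v 0 i)).length
  rw [φ.suffix_onInf] at hpal' hrep'
  subst hv
  obtain ⟨k, hk⟩ := exists_goal_of_search φ hpal' hrep' goal 40 _ _ hx
    (by simp [factor_suffix]) (by simp)
  exact ⟨k, by simpa [factor_suffix] using hk⟩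

/-- Whether `x` has a prefix in the list. -/
def hasPrefixIn (l : List (List (Fin 3))) (x : List (Fin 3)) : Bool :=
  l.any fun y => y.isPrefixOf x

theorem factor_eq_of_isPrefix {α : Type*} {v : ℕ → α} {i n : ℕ} {y : List α}
    (hy : y <+: factor v i n) : factor v i y.length = y := by
  obtain ⟨t, ht⟩ := hy
  have hlen : n = y.length + t.length := by
    have := congrArg List.length ht
    simp at this
    omega
  rw [hlen, factor_add] at ht
  exact ((List.append_inj ht (by simp)).1).symm

theorem exists_mem_of_hasPrefixIn {l : List (List (Fin 3))} {v : ℕ → Fin 3} {i : ℕ}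
    (h : ∃ n, hasPrefixIn l (factor v i n) = true) : ∃ y ∈ l, factor v i y.length = y := by
  obtain ⟨n, hn⟩ := h
  simp only [hasPrefixIn, List.any_eq_true, List.isPrefixOf_iff_prefix] at hn
  obtain ⟨y, hy, hyn⟩ := hn
  exact ⟨y, hy, factor_eq_of_isPrefix hyn⟩

/-- The images of the letters, each followed by `0`. -/
def blocks (φ : Morphism (Fin 3) (Fin 3)) : List (List (Fin 3)) :=
  [0, 1, 2].map fun a => φ.toFun a ++ [0]

theorem mem_blocks {φ : Morphism (Fin 3) (Fin 3)} {y : List (Fin 3)} (hy : y ∈ blocks φ) :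
    ∃ a, y = φ.toFun a ++ [0] := by
  obtain ⟨a, -, rfl⟩ := List.mem_map.1 hy
  exact ⟨a, rfl⟩

theorem factor_append_singleton {α : Type*} {v : ℕ → α} {i : ℕ} {y : List α} {z : α}
    (h : factor v i (y ++ [z]).length = y ++ [z]) :
    factor v i y.length = y ∧ v (i + y.length) = z := by
  rw [List.length_append, List.length_singleton, factor_succ] at h
  have h₁ := List.append_inj h (by simp)
  exact ⟨h₁.1, by simpa using h₁.2⟩

theorem exists_eq_zero [DecidableEq β] {φ : Morphism (Fin 3) β} {gens : List ((β → ℕ) × ℕ)}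
    (hzero : ∀ c, check φ gens (fun x => x.contains 0) [c] = true) {v : ℕ → Fin 3}
    (hpal : HasNewPalindromes (φ.onInf v)) (hrep : RepetitionFree gens (φ.onInf v)) :
    ∃ i, v i = 0 := by
  obtain ⟨k, hk⟩ := exists_goal_of_check (hzero (v 0)) hpal hrep (i := 0) (n := 1) rfl
  simp only [List.contains_iff_mem, factor, List.mem_map] at hk
  obtain ⟨j, -, hj⟩ := hk
  exact ⟨_, hj⟩

/-- The `0` after a block marks a position where the hypothesis applies again, so the parsing never
stops. -/
theorem exists_suffix_eq_onInf_of_blocks {φ : Morphism (Fin 3) (Fin 3)} {v : ℕ → Fin 3}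
    (hv : ∀ i, v i = 0 → ∃ a, factor v i (φ.toFun a ++ [0]).length = φ.toFun a ++ [0])
    (hzero : ∃ i, v i = 0) : ∃ v' i, suffix v i = φ.onInf v' := by
  obtain ⟨i, hi⟩ := hzero
  obtain ⟨v', hv'⟩ := φ.exists_eq_onInf v (fun i => v i = 0)
    (fun i hi => (hv i hi).imp fun a ha => factor_append_singleton ha) i hi
  exact ⟨v', i, hv'⟩

theorem exists_suffix_eq_h_onInf [DecidableEq β] {φ : Morphism (Fin 3) β}
    {gens : List ((β → ℕ) × ℕ)}
    (hblock : check φ gens (hasPrefixIn (blocks h)) [0] = true)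
    (hzero : ∀ c, check φ gens (fun x => x.contains 0) [c] = true)
    {v : ℕ → Fin 3} (hpal : HasNewPalindromes (φ.onInf v))
    (hrep : RepetitionFree gens (φ.onInf v)) :
    ∃ v' i, suffix v i = h.onInf v' := by
  refine exists_suffix_eq_onInf_of_blocks (fun i hi => ?_) (exists_eq_zero hzero hpal hrep)
  obtain ⟨y, hy, hyv⟩ := exists_mem_of_hasPrefixIn
    (exists_goal_of_check hblock hpal hrep (i := i) (n := 1) (by rw [factor_one, hi]))
  obtain ⟨a, rfl⟩ := mem_blocks hy
  exact ⟨a, hyv⟩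

/-- If all words that start with `0` start with a block of `φ` or of `ψ`, and a block of `ψ` can
only be followed by another one, then a suffix of `v` is an image under `φ` or under `ψ`. -/
theorem exists_suffix_eq_onInf_or [DecidableEq β] {χ : Morphism (Fin 3) β}
    {φ ψ : Morphism (Fin 3) (Fin 3)} {gens : List ((β → ℕ) × ℕ)}
    (hblock : check χ gens (hasPrefixIn (blocks φ ++ blocks ψ)) [0] = true)
    (hnext : ∀ a, check χ gens (hasPrefixIn ((blocks ψ).map (ψ.toFun a ++ ·)))
      (ψ.toFun a ++ [0]) = true)
    (hzero : ∀ c, check χ gens (fun x => x.contains 0) [c] = true)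
    {v : ℕ → Fin 3} (hpal : HasNewPalindromes (χ.onInf v))
    (hrep : RepetitionFree gens (χ.onInf v)) :
    (∃ v' i, suffix v i = φ.onInf v') ∨ ∃ v' i, suffix v i = ψ.onInf v' := by
  by_cases hψ : ∃ i a, factor v i (ψ.toFun a ++ [0]).length = ψ.toFun a ++ [0]
  · right
    obtain ⟨i, hi⟩ := hψ
    obtain ⟨v', hv'⟩ := ψ.exists_eq_onInf v
      (fun i => ∃ a, factor v i (ψ.toFun a ++ [0]).length = ψ.toFun a ++ [0]) (by
        rintro i ⟨a, ha⟩
        refine ⟨a, (factor_append_singleton ha).1, ?_⟩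
        obtain ⟨y, hy, hyv⟩ := exists_mem_of_hasPrefixIn
          (exists_goal_of_check (hnext a) hpal hrep ha)
        obtain ⟨y', hy', rfl⟩ := List.mem_map.1 hy
        obtain ⟨b, rfl⟩ := mem_blocks hy'
        refine ⟨b, ?_⟩
        rw [List.length_append, factor_add] at hyv
        exact (List.append_inj hyv (by simp)).2) i hi
    exact ⟨v', i, hv'⟩
  · left
    refine exists_suffix_eq_onInf_of_blocks (fun i hi => ?_) (exists_eq_zero hzero hpal hrep)
    obtain ⟨y, hy, hyv⟩ := exists_mem_of_hasPrefixIn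
      (exists_goal_of_check hblock hpal hrep (i := i) (n := 1) (by rw [factor_one, hi]))
    rcases List.mem_append.1 hy with hy | hy
    · obtain ⟨a, rfl⟩ := mem_blocks hy
      exact ⟨a, hyv⟩
    · obtain ⟨a, rfl⟩ := mem_blocks hy
      exact absurd ⟨i, a, hyv⟩ hψ

end Desubstitution

/-! ### The finite searches -/

section Certificates

/-- Unit weights, for exact exponents. -/
def unitGens : List ((Fin 2 → ℕ) × ℕ) := [(fun _ => 1, 0)]

/-- The weights of the letters and of their common extension under `f` and under `f ∘ h`. The cone
that they span contains those under `f ∘ g` and is closed under composition with `h`. -/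
def ternaryGens : List ((Fin 3 → ℕ) × ℕ) := [(![1, 2, 3], 1), (![3, 4, 7], 2)]

set_option maxRecDepth 100000

theorem check_f_blocks :
    check f unitGens (hasPrefixIn (blocks h ++ blocks g)) [0] = true := by decide +kernel

theorem check_f_next : ∀ a, check f unitGens (hasPrefixIn ((blocks g).map (g.toFun a ++ ·)))
    (g.toFun a ++ [0]) = true := by decide +kernel

theorem check_f_zero : ∀ c, check f unitGens (fun x => x.contains 0) [c] = true := by
  decide +kernel

theorem check_fh_blocks :
    check (f.comp h) unitGens (hasPrefixIn (blocks h)) [0] = true := by decide +kernel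

theorem check_fh_zero : ∀ c, check (f.comp h) unitGens (fun x => x.contains 0) [c] = true := by
  decide +kernel

theorem check_fg_blocks :
    check (f.comp g) unitGens (hasPrefixIn (blocks h)) [0] = true := by decide +kernel

theorem check_fg_zero : ∀ c, check (f.comp g) unitGens (fun x => x.contains 0) [c] = true := by
  decide +kernel

theorem check_gh_blocks :
    check (g.comp h) ternaryGens (hasPrefixIn (blocks h)) [0] = true := by decide +kernel

theorem check_gh_zero : ∀ c, check (g.comp h) ternaryGens (fun x => x.contains 0) [c] = true := by
  decide +kernel

theorem check_hh_blocks :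
    check (h.comp h) ternaryGens (hasPrefixIn (blocks h)) [0] = true := by decide +kernel

theorem check_hh_zero : ∀ c, check (h.comp h) ternaryGens (fun x => x.contains 0) [c] = true := by
  decide +kernel

end Certificates

/-! ### Pulling the conditions back along `f`, `g` and `h` -/

theorem isMarked_f : f.IsMarked 0 := by
  intro a
  fin_cases a
  exacts [⟨_, rfl, by decide, rfl⟩, ⟨_, rfl, by decide, rfl⟩, ⟨_, rfl, by decide, rfl⟩]

theorem isMarked_g : g.IsMarked 0 := by
  intro a
  fin_cases a
  exacts [⟨_, rfl, by decide, rfl⟩, ⟨_, rfl, by decide, rfl⟩, ⟨_, rfl, by decide, rfl⟩]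

theorem isMarked_h : h.IsMarked 0 := by
  intro a
  fin_cases a
  exacts [⟨_, rfl, by decide, rfl⟩, ⟨_, rfl, by decide, rfl⟩, ⟨_, rfl, by decide, rfl⟩]

theorem injective_f : Function.Injective f.toFun := by decide

theorem injective_g : Function.Injective g.toFun := by decide

theorem injective_h : Function.Injective h.toFun := by decide

theorem RepetitionFree.of_f_onInf {v : ℕ → Fin 3} (hv : RepetitionFree unitGens (f.onInf v)) :
    RepetitionFree [(![1, 2, 3], 1)] v := by
  refine (hv.of_onInf f (p := [0]) (by decide)).mono ?_
  intro G hG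
  obtain rfl := List.mem_singleton.1 hG
  exact ⟨fun _ => 1, by decide, by decide⟩

theorem RepetitionFree.ternaryGens_of_f_onInf {v : ℕ → Fin 3}
    (hv : RepetitionFree unitGens (f.onInf v)) : RepetitionFree ternaryGens v := by
  intro i p m hp hm
  obtain ⟨G, hG, hlt⟩ := hv.of_f_onInf i p m hp hm
  exact ⟨G, by simp_all [ternaryGens], hlt⟩

theorem RepetitionFree.ternaryGens_of_f_g_onInf {v : ℕ → Fin 3}
    (hv : RepetitionFree unitGens (f.onInf (g.onInf v))) : RepetitionFree ternaryGens v := by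
  refine (hv.of_f_onInf.of_onInf g (p := [0, 1]) (by decide)).mono ?_
  intro G hG
  obtain rfl := List.mem_singleton.1 hG
  -- The constant identifies the generator. The pulled back weight is `(5, 8, 13)` with constant 4,
  -- which is `2 * ((1, 2, 3), 1) + ((3, 4, 7), 2)`.
  exact ⟨fun G => if G.2 = 1 then 2 else 1, by decide, by decide⟩

theorem RepetitionFree.ternaryGens_of_h_onInf {v : ℕ → Fin 3}
    (hv : RepetitionFree ternaryGens (h.onInf v)) : RepetitionFree ternaryGens v := by
  refine (hv.of_onInf h (p := [0]) (by decide)).mono ?_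
  intro G hG
  simp only [ternaryGens, List.map_cons, List.map_nil, List.mem_cons, List.not_mem_nil,
    or_false] at hG
  rcases hG with rfl | rfl
  -- The first generator pulls back to the second, and the second to `((7, 10, 17), 5)`, which is
  -- the first plus twice the second.
  · exact ⟨fun G => if G.2 = 1 then 0 else 1, by decide, by decide⟩
  · exact ⟨fun G => if G.2 = 1 then 1 else 2, by decide, by decide⟩

theorem of_iterate_h_onInf {v : ℕ → Fin 3} (n : ℕ) (hpal : HasNewPalindromes (h.onInf^[n] v))
    (hrep : RepetitionFree ternaryGens (h.onInf^[n] v)) :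
    HasNewPalindromes v ∧ RepetitionFree ternaryGens v := by
  induction n with
  | zero => exact ⟨hpal, hrep⟩
  | succ n ih =>
    rw [Function.iterate_succ_apply'] at hpal hrep
    exact ih (isMarked_h.hasNewPalindromes injective_h hpal) hrep.ternaryGens_of_h_onInf

theorem exists_suffix_iterate_h_onInf {v v' : ℕ → Fin 3} (hv : ∃ i, suffix v i = v') (n : ℕ) :
    ∃ i, suffix (h.onInf^[n] v) i = h.onInf^[n] v' := by
  induction n with
  | zero => exact hv
  | succ n ih =>
    rw [Function.iterate_succ_apply', Function.iterate_succ_apply']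
    exact h.exists_suffix_onInf ih

/-- One more application of `h` can be undone, after removing a prefix. -/
theorem exists_suffix_eq_of_iterate_add_two {v : ℕ → Fin 3} (n : ℕ)
    (hpal : HasNewPalindromes (h.onInf^[n + 2] v))
    (hrep : RepetitionFree ternaryGens (h.onInf^[n + 2] v)) :
    ∃ v' i, suffix v i = h.onInf v' := by
  rw [Function.iterate_add_apply] at hpal hrep
  obtain ⟨hpal', hrep'⟩ := of_iterate_h_onInf n hpal hrep
  have hcomp : h.onInf^[2] v = (h.comp h).onInf v := (h.comp_onInf h v).symm
  rw [hcomp] at hpal' hrep'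
  exact exists_suffix_eq_h_onInf check_hh_blocks check_hh_zero hpal' hrep'

/-- With a single `h` the search runs on the binary word itself; with more, `f` is stripped off and
the two innermost copies of `h` suffice. -/
theorem exists_suffix_eq_h_onInf_of_f {v : ℕ → Fin 3} {n : ℕ}
    (hpal : HasNewPalindromes (f.onInf (h.onInf^[n + 1] v)))
    (hrep : RepetitionFree unitGens (f.onInf (h.onInf^[n + 1] v))) :
    ∃ v' i, suffix v i = h.onInf v' := by
  match n with
  | 0 =>
    rw [zero_add, Function.iterate_one, ← Morphism.comp_onInf] at hpal hrep
    exact exists_suffix_eq_h_onInf check_fh_blocks check_fh_zero hpal hrep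
  | n + 1 =>
    exact exists_suffix_eq_of_iterate_add_two n (isMarked_f.hasNewPalindromes injective_f hpal)
      hrep.ternaryGens_of_f_onInf

theorem exists_suffix_eq_h_onInf_of_f_g {v : ℕ → Fin 3} {n : ℕ}
    (hpal : HasNewPalindromes (f.onInf (g.onInf (h.onInf^[n] v))))
    (hrep : RepetitionFree unitGens (f.onInf (g.onInf (h.onInf^[n] v)))) :
    ∃ v' i, suffix v i = h.onInf v' := by
  have hpal' := isMarked_f.hasNewPalindromes injective_f hpal
  match n with
  | 0 =>
    rw [Function.iterate_zero_apply, ← Morphism.comp_onInf] at hpal hrep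
    exact exists_suffix_eq_h_onInf check_fg_blocks check_fg_zero hpal hrep
  | 1 =>
    have hrep' := hrep.ternaryGens_of_f_onInf
    rw [Function.iterate_one, ← Morphism.comp_onInf] at hpal' hrep'
    exact exists_suffix_eq_h_onInf check_gh_blocks check_gh_zero hpal' hrep'
  | n + 2 =>
    exact exists_suffix_eq_of_iterate_add_two n (isMarked_g.hasNewPalindromes injective_g hpal')
      hrep.ternaryGens_of_f_g_onInf

/-- The cube `111` has exponent `3 ≥ 14 / 5`, so each `0` is followed by at most two letters `1`
before the next `0`. -/
theorem exists_suffix_eq_f_onInf {w : ℕ → Fin 2} (hw : RepetitionFree unitGens w) :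
    ∃ v i, suffix w i = f.onInf v := by
  have hcube : ∀ i, w i = 1 → w (i + 1) = 1 → w (i + 2) ≠ 1 := by
    intro i h₀ h₁ h₂
    obtain ⟨G, hG, hlt⟩ := hw i 1 2 one_pos (by
      intro j hj
      interval_cases j <;> simp_all [Nat.add_assoc])
    obtain rfl := List.mem_singleton.1 hG
    simp [weight, factor, List.range_succ] at hlt
  have hone : ∀ i, w i ≠ 0 → w i = 1 := fun i hi => by omega
  have hzero : ∃ i, w i = 0 := by
    by_contra! hcon
    exact hcon 2 (by have := hcube 0 (hone _ (hcon 0)) (hone _ (hcon 1)); simp at this; omega)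
  obtain ⟨i, hi⟩ := hzero
  obtain ⟨v, hv⟩ := f.exists_eq_onInf w (fun i => w i = 0) (fun i hi => by
    by_cases h₁ : w (i + 1) = 0
    · exact ⟨0, by simp [f, factor, hi], h₁⟩
    · by_cases h₂ : w (i + 2) = 0
      · exact ⟨1, by simp [f, factor, hi, hone _ h₁, List.range_succ], h₂⟩
      · refine ⟨2, by simp [f, factor, hi, hone _ h₁, hone _ h₂, List.range_succ], ?_⟩
        have := hcube (i + 1) (hone _ h₁) (hone _ h₂)
        show w (i + 3) = 0
        rw [Nat.add_assoc] at this
        simp at this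
        omega) i hi
  exact ⟨v, i, hv⟩

end BinaryRich

/-! ### The theorem -/

open BinaryRich in
theorem theorem1 (w : ℕ → Fin 2) (hrich : BinaryRich.IsRichInf w)
    (hfree : BinaryRich.PowerFree (14 / 5 : ℝ) w) (n : ℕ) (hn : 1 ≤ n) :
    ∃ (m : ℕ) (wn : ℕ → Fin 3),
      BinaryRich.suffix w m = BinaryRich.f.onInf (BinaryRich.h.onInf^[n] wn) ∨
      BinaryRich.suffix w m =
        BinaryRich.f.onInf (BinaryRich.g.onInf (BinaryRich.h.onInf^[n] wn)) := by
  have hpal : ∀ m, HasNewPalindromes (suffix w m) := hrich.hasNewPalindromes.suffix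
  have hrep : ∀ m, RepetitionFree unitGens (suffix w m) := hfree.repetitionFree.suffix
  induction n, hn using Nat.le_induction with
  | base =>
    obtain ⟨u, i, hu⟩ := exists_suffix_eq_f_onInf hfree.repetitionFree
    have hpal' := hpal i
    have hrep' := hrep i
    rw [hu] at hpal' hrep'
    rcases exists_suffix_eq_onInf_or check_f_blocks check_f_next check_f_zero hpal' hrep' with
      ⟨v, j, hv⟩ | ⟨v, j, hv⟩
    · obtain ⟨k, hk⟩ := f.exists_suffix_onInf ⟨j, hv⟩
      exact ⟨i + k, v, Or.inl (by rw [← suffix_suffix, hu, hk]; rfl)⟩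
    · obtain ⟨k, hk⟩ := f.exists_suffix_onInf ⟨j, hv⟩
      rw [← hu, suffix_suffix] at hk
      have hpal' := hpal (i + k)
      have hrep' := hrep (i + k)
      rw [hk] at hpal' hrep'
      -- The `g` case has no `h` yet, so one more desubstitution is needed to reach exponent 1.
      obtain ⟨v', hv'⟩ := exists_suffix_eq_h_onInf_of_f_g (n := 0) hpal' hrep'
      obtain ⟨l, hl⟩ := f.exists_suffix_onInf (g.exists_suffix_onInf hv')
      exact ⟨i + k + l, v', Or.inr (by rw [← suffix_suffix, hk, hl]; rfl)⟩
  | succ n hn ih =>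
    obtain ⟨m, v, hv | hv⟩ := ih
    · have hpal' := hpal m
      have hrep' := hrep m
      obtain ⟨n, rfl⟩ := Nat.exists_eq_add_of_le' hn
      rw [hv] at hpal' hrep'
      obtain ⟨v', hv'⟩ := exists_suffix_eq_h_onInf_of_f hpal' hrep'
      obtain ⟨l, hl⟩ := f.exists_suffix_onInf (exists_suffix_iterate_h_onInf hv' (n + 1))
      exact ⟨m + l, v', Or.inl (by
        rw [← suffix_suffix, hv, hl, Function.iterate_succ_apply _ (n + 1)])⟩
    · have hpal' := hpal m
      have hrep' := hrep m
      rw [hv] at hpal' hrep'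
      obtain ⟨v', hv'⟩ := exists_suffix_eq_h_onInf_of_f_g hpal' hrep'
      obtain ⟨l, hl⟩ := f.exists_suffix_onInf
        (g.exists_suffix_onInf (exists_suffix_iterate_h_onInf hv' n))
      exact ⟨m + l, v', Or.inr (by rw [← suffix_suffix, hv, hl, Function.iterate_succ_apply])⟩
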